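/- For a topological space $X$, a *cover* of $X$ is a family $\mathcal U$ of subsets of $X$ with $\bigcup\mathcal U=X$ and $X\notin\mathcal U$. A cover $\mathcal U$ is an *$\omega$-cover* if each finite subset of $X$ is contained in some member of $\mathcal U$; it is a *$\gamma$-cover* if it is infinite and each point of $X$ belongs to all but finitely many members of $\mathcal U$. Let $\mathrm{O}(X),\Omega(X),\Gamma(X)$ be the families of open covers, open $\omega$-covers and open $\gamma$-covers of $X$, and let $\mathrm{B}_\Omega(X),\mathrm{B}_\Gamma(X)$ be the families of countable $\omega$-covers and countable $\gamma$-covers of $X$ by Borel sets. For families $\mathcal A,\mathcal B$ of covers, $\binom{\mathcal A}{\mathcal B}$ says that each member of $\mathcal A$ contains (as a subfamily) a member of $\mathcal B$. The space $X$ is a *$\gamma$-set* if it satisfies $\binom{\Omega}{\Gamma}$, and it is *Menger* if it satisfies $\mathsf S_{\mathrm{fin}}(\mathrm O,\mathrm O)$: for each sequence $(\mathcal U_n)_{n\in\mathbb N}$ in $\mathrm O(X)$ there are finite $\mathcal F_n\subseteq\mathcal U_n$ with $\bigcup_n\mathcal F_n\in\mathrm O(X)$. A set $D\subseteq\mathbb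 N^{\mathbb N}$ is *dominating* if for each $f\in\mathbb N^{\mathbb N}$ there is $g\in D$ with $f(n)\le g(n)$ for all but finitely many $n$. **Theorem.** Assume the Continuum Hypothesis ($2^{\aleph_0}=\aleph_1$). There are sets $X,Y\subseteq\mathbb R$ such that $X$ and $Y$ satisfy $\binom{\mathrm B_\Omega}{\mathrm B_\Gamma}$ and both are $\gamma$-sets, the product space $X\times Y$ is not Menger, and there is a continuous map from $X\times Y$ onto a dominating subset of $\mathbb N^{\mathbb N}$. -/

import Mathlib

namespace SelCov

/-- A family `U` of subsets of `X` is a cover of `X` if its union is `X`, while no single member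
of `U` is all of `X`. -/
def IsCover {X : Type*} (U : Set (Set X)) : Prop :=
  ⋃₀ U = Set.univ ∧ Set.univ ∉ U

/-- Every finite subset of `X` is contained in some member of `U`. -/
def CoversFinite {X : Type*} (U : Set (Set X)) : Prop :=
  ∀ F : Set X, F.Finite → ∃ u ∈ U, F ⊆ u

/-- `U` is infinite, and every point of `X` belongs to all but finitely many members of `U`. -/
def CoversCofinitely {X : Type*} (U : Set (Set X)) : Prop :=
  U.Infinite ∧ ∀ x : X, {u ∈ U | x ∉ u}.Finite

/-- The family `O(X)` of all open covers of `X`. -/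
def OpenCovers (X : Type*) [TopologicalSpace X] : Set (Set (Set X)) :=
  {U | IsCover U ∧ ∀ u ∈ U, IsOpen u}

/-- The family `Ω(X)` of all open ω-covers of `X`. -/
def OmegaCovers (X : Type*) [TopologicalSpace X] : Set (Set (Set X)) :=
  {U | U ∈ OpenCovers X ∧ CoversFinite U}

/-- The family `Γ(X)` of all open γ-covers of `X`. -/
def GammaCovers (X : Type*) [TopologicalSpace X] : Set (Set (Set X)) :=
  {U | U ∈ OpenCovers X ∧ CoversCofinitely U}

/-- The family `B(X)` of all countable Borel covers of `X`. -/
def BorelCovers (X : Type*) [TopologicalSpace X] : Set (Set (Set X)) :=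
  {U | IsCover U ∧ U.Countable ∧ ∀ u ∈ U, @MeasurableSet X (borel X) u}

/-- The family `BΩ(X)` of all countable Borel ω-covers of `X`. -/
def BorelOmegaCovers (X : Type*) [TopologicalSpace X] : Set (Set (Set X)) :=
  {U | U ∈ BorelCovers X ∧ CoversFinite U}

/-- The family `BΓ(X)` of all countable Borel γ-covers of `X`. -/
def BorelGammaCovers (X : Type*) [TopologicalSpace X] : Set (Set (Set X)) :=
  {U | U ∈ BorelCovers X ∧ CoversCofinitely U}

/-- The property `(A over B)`: each member of `A` contains a member of `B`. -/
def Binom {X : Type*} (A B : Set (Set (Set X))) : Prop :=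
  ∀ U ∈ A, ∃ V ∈ B, V ⊆ U

/-- The selection principle `S_fin(A, B)`: from each sequence of members of `A` one can select
finite subfamilies whose union is a member of `B`. -/
def SFin {X : Type*} (A B : Set (Set (Set X))) : Prop :=
  ∀ U : ℕ → Set (Set X), (∀ n, U n ∈ A) →
    ∃ F : ℕ → Set (Set X), (∀ n, F n ⊆ U n ∧ (F n).Finite) ∧ (⋃ n, F n) ∈ B

/-- `X` satisfies `(BΩ over BΓ)`. -/
def IsBorelGammaSpace (X : Type*) [TopologicalSpace X] : Prop :=
  Binom (BorelOmegaCovers X) (BorelGammaCovers X)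

/-- `X` is a γ-set, that is, `X` satisfies `(Ω over Γ)`. -/
def IsGammaSpace (X : Type*) [TopologicalSpace X] : Prop :=
  Binom (OmegaCovers X) (GammaCovers X)

/-- `X` has Menger's property `S_fin(O, O)`. -/
def IsMenger (X : Type*) [TopologicalSpace X] : Prop :=
  SFin (OpenCovers X) (OpenCovers X)

/-- `D ⊆ ℕ^ℕ` is dominating: every `f` is eventually bounded by some member of `D`. -/
def IsDominating (D : Set (ℕ → ℕ)) : Prop :=
  ∀ f : ℕ → ℕ, ∃ g ∈ D, ∀ᶠ n in Filter.atTop, f n ≤ g n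

end SelCov

/-! The sets are built in the Cantor space by recursion along a well-order with countable initial
segments, which CH provides for the pairs of a Borel sequence `B` and a function `f`. Each stage
takes a Silver condition with infinitely many free coordinates that almost refines the earlier ones
and decides `B` over the points chosen so far (`SilverCond.exists_decides`): either every branch,
with its finite modifications, spoils the ω-covering, or one subsequence covers cofinitely all old
points and all branches. Later points are branches too, so the verdict holds for the whole set
(`seqBorelGamma_of_tower`).

One condition serves both sets, and it has two branches that differ exactly on a set as sparse as
`f` demands (`SilverCond.exists_pair`). Thus sending `(x, y)` to the increasing enumeration of `{n |
x n ≠ y n}` has dominating range. New points avoid the finite modifications of earlier points of the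
other set, so these sets are infinite and the map is continuous. A dominating continuous image
refutes Menger's property, and an embedding moves everything into the real line. -/

open Set Filter Topology

/-! ### Silver conditions, diagonalization and fusion -/

/-- A Silver condition on `ℕ → Bool`: the coordinates outside `free` are prescribed by `val`. -/
structure SilverCond where
  val : ℕ → Bool
  free : Set ℕ

namespace SilverCond

/-- The points obeying the prescriptions of `p` from coordinate `N` on. -/
def cube (N : ℕ) (p : SilverCond) : Set (ℕ → Bool) :=
  {x | ∀ n ≥ N, n ∉ p.free → x n = p.val n}

/-- The points obeying all but finitely many prescriptions of `p`. -/
def branches (p : SilverCond) : Set (ℕ → Bool) :=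
  {x | ∃ N, x ∈ p.cube N}

/-- From coordinate `N` on, `q` prescribes everything that `p` does. -/
def Refines (N : ℕ) (q p : SilverCond) : Prop :=
  ∀ n ≥ N, n ∉ p.free → n ∉ q.free ∧ q.val n = p.val n

/-- `q` prescribes all but finitely many of the values prescribed by `p`. -/
def AlmostRefines (q p : SilverCond) : Prop :=
  ∃ N, q.Refines N p

lemma Refines.refl (N : ℕ) (p : SilverCond) : p.Refines N p := fun _ _ h => ⟨h, rfl⟩

lemma Refines.mono {M N : ℕ} (h : M ≤ N) {q p : SilverCond} (hq : q.Refines M p) :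
    q.Refines N p := fun n hn => hq n (h.trans hn)

lemma Refines.trans {N : ℕ} {r q p : SilverCond} (h₁ : r.Refines N q) (h₂ : q.Refines N p) :
    r.Refines N p := fun n hn hp =>
  ⟨(h₁ n hn (h₂ n hn hp).1).1, (h₁ n hn (h₂ n hn hp).1).2.trans (h₂ n hn hp).2⟩

lemma AlmostRefines.refl (p : SilverCond) : p.AlmostRefines p := ⟨0, Refines.refl 0 p⟩

lemma AlmostRefines.trans {r q p : SilverCond} :
    r.AlmostRefines q → q.AlmostRefines p → r.AlmostRefines p := by
  rintro ⟨M, hM⟩ ⟨N, hN⟩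
  exact ⟨max M N, (hM.mono (le_max_left _ _)).trans (hN.mono (le_max_right _ _))⟩

lemma cube_mono {M N : ℕ} (h : M ≤ N) (p : SilverCond) : p.cube M ⊆ p.cube N :=
  fun _ hx n hn => hx n (h.trans hn)

lemma Refines.cube_subset {N : ℕ} {q p : SilverCond} (h : q.Refines N p) :
    q.cube N ⊆ p.cube N := fun _ hx n hn hp => (hx n hn (h n hn hp).1).trans (h n hn hp).2

lemma AlmostRefines.branches_subset {q p : SilverCond} (h : q.AlmostRefines p) :
    q.branches ⊆ p.branches := by
  obtain ⟨N, hN⟩ := h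
  rintro x ⟨M, hM⟩
  exact ⟨max M N, (hN.mono (le_max_right _ _)).cube_subset (cube_mono (le_max_left _ _) q hM)⟩

lemma branches_congr {p : SilverCond} {x y : ℕ → Bool} (hx : x ∈ p.branches)
    (h : y =ᶠ[atTop] x) : y ∈ p.branches := by
  obtain ⟨N, hN⟩ := hx
  obtain ⟨M, hM⟩ := eventually_atTop.1 h
  exact ⟨max M N, fun n hn hp => (hM n (le_of_max_le_left hn)).trans
    (hN n (le_of_max_le_right hn) hp)⟩

/-- Every branch of `p` is almost equal to a point in the cube of `p`. -/
lemma exists_mem_cube_zero {p : SilverCond} {x : ℕ → Bool} (hx : x ∈ p.branches) :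
    ∃ y ∈ p.cube 0, y =ᶠ[atTop] x := by
  obtain ⟨N, hN⟩ := hx
  refine ⟨fun n => if n < N then p.val n else x n, fun n _ hp => ?_, ?_⟩
  · by_cases h : n < N
    · simp [h]
    · simpa [h] using hN n (not_lt.1 h) hp
  · filter_upwards [eventually_ge_atTop N] with n hn
    simp [not_lt.2 hn]

/-- Diagonalization: conditions `p k` refining each other past the increasing bounds `N k` are
all refined by the condition that follows `p k` on the interval from `N k` to `N (k + 1)`. -/
lemma exists_diagonal {T : Set ℕ} {p : ℕ → SilverCond} {N : ℕ → ℕ} (p₀ : SilverCond)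
    (hN : ∀ k, ∃ m ∈ (p k).free ∩ T, N k ≤ m ∧ m < N (k + 1))
    (hp : ∀ k, (p (k + 1)).Refines (N (k + 1)) (p k)) (h₀ : (p 0).Refines (N 0) p₀) :
    ∃ q : SilverCond, (q.free ∩ T).Infinite ∧ q.Refines 0 p₀ ∧ ∀ k, q.Refines (N k) (p k) := by
  have hmono : StrictMono N := strictMono_nat_of_lt_succ fun k => by
    obtain ⟨m, -, h₁, h₂⟩ := hN k
    omega
  have hdec : ∀ j k, (p (j + k)).Refines (N (j + k)) (p j) := by
    intro j k
    induction k with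
    | zero => exact Refines.refl _ _
    | succ k ih =>
      exact (hp (j + k)).trans (ih.mono (hmono.monotone (by omega)))
  -- The last `k` with `N k ≤ n`. Below `N 0` the default 0 is meaningless, so `p₀` is followed
  -- there.
  let b : ℕ → ℕ := fun n => Nat.findGreatest (fun k => N k ≤ n) n
  have hb : ∀ {k n}, N k ≤ n → k ≤ b n ∧ N (b n) ≤ n := by
    intro k n h
    have hk : k ≤ n := (hmono.id_le k).trans h
    exact ⟨Nat.le_findGreatest hk h, Nat.findGreatest_spec (P := fun k => N k ≤ n) hk h⟩
  have hb' : ∀ {k n}, N k ≤ n → n < N (k + 1) → b n = k := by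
    intro k n h₁ h₂
    have h := hb h₁
    have : b n < k + 1 := hmono.lt_iff_lt.1 (h.2.trans_lt h₂)
    omega
  let c : ℕ → SilverCond := fun n => if n < N 0 then p₀ else p (b n)
  have hc : ∀ {n k}, N k ≤ n → c n = p (b n) := by
    intro n k h
    have := (hmono.monotone (Nat.zero_le k)).trans h
    simp [c, not_lt.2 this]
  have href : ∀ k, ∀ n ≥ N k, n ∉ (p k).free →
      n ∉ (c n).free ∧ (c n).val n = (p k).val n := by
    intro k n hn hnp
    rw [hc hn]
    obtain ⟨h₁, h₂⟩ := hb hn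
    obtain ⟨j, hj⟩ := Nat.exists_eq_add_of_le h₁
    rw [hj] at h₂ ⊢
    exact hdec k j n h₂ hnp
  refine ⟨⟨fun n => (c n).val n, {n | n ∈ (c n).free}⟩, ?_, ?_, fun k => href k⟩
  · refine infinite_of_not_bddAbove ?_
    rintro ⟨M, hM⟩
    obtain ⟨m, hm, h₁, h₂⟩ := hN (M + 1)
    have hmem : m ∈ {n | n ∈ (c n).free} ∩ T := by
      refine ⟨?_, hm.2⟩
      change m ∈ (c m).free
      rw [hc h₁, hb' h₁ h₂]
      exact hm.1
    have := hM hmem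
    have := hmono.id_le (M + 1)
    simp only [id] at this
    omega
  · intro n _ hn
    by_cases h : n < N 0
    · simpa [c, h] using hn
    · have h' := h₀ n (not_lt.1 h) hn
      have := href 0 n (not_lt.1 h) h'.1
      exact ⟨this.1, this.2.trans h'.2⟩

/-- Fusion: if below each condition and past each bound the requirements `D k` can be met, then
some condition refines conditions meeting all of them. -/
lemma fusion {T : Set ℕ} {I : SilverCond → Prop} (hI : ∀ p, I p → (p.free ∩ T).Infinite)
    {D : ℕ → ℕ → SilverCond → Prop}
    (step : ∀ k N p, I p → ∃ q, I q ∧ q.Refines N p ∧ D k N q)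
    (N₀ : ℕ) (p₀ : SilverCond) (h₀ : I p₀) :
    ∃ (q : SilverCond) (N : ℕ → ℕ), N 0 = N₀ ∧ StrictMono N ∧ (q.free ∩ T).Infinite ∧
      q.Refines 0 p₀ ∧ ∀ k, ∃ p, D k (N k) p ∧ q.Refines (N k) p := by
  choose! f hfI hfR hfD using step
  have hg : ∀ (p : SilverCond) (M : ℕ), ∃ M', I p → ∃ m ∈ p.free ∩ T, M ≤ m ∧ m < M' := by
    intro p M
    by_cases h : I p
    · obtain ⟨m, hm, hM⟩ := (hI p h).exists_gt M
      exact ⟨m + 1, fun _ => ⟨m, hm, hM.le, m.lt_succ_self⟩⟩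
    · exact ⟨0, fun h' => absurd h' h⟩
  choose g hg using hg
  -- Current condition and bound. The next bound passes a free coordinate in `T`, which the diagonal
  -- condition will keep.
  let s : ℕ → SilverCond × ℕ := fun k => Nat.rec (f 0 N₀ p₀, N₀)
    (fun k s => (f (k + 1) (g s.1 s.2) s.1, g s.1 s.2)) k
  have hsI : ∀ k, I (s k).1 := by
    intro k
    induction k with
    | zero => exact hfI 0 N₀ p₀ h₀
    | succ k ih => exact hfI (k + 1) _ _ ih
  have hN : ∀ k, ∃ m ∈ (s k).1.free ∩ T, (s k).2 ≤ m ∧ m < (s (k + 1)).2 :=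
    fun k => hg _ _ (hsI k)
  obtain ⟨q, hq, hq₀, hqr⟩ := exists_diagonal (T := T) (p := fun k => (s k).1)
    (N := fun k => (s k).2) p₀ hN (fun k => hfR (k + 1) _ _ (hsI k)) (hfR 0 N₀ p₀ h₀)
  refine ⟨q, fun k => (s k).2, rfl, strictMono_nat_of_lt_succ fun k => ?_, hq, hq₀,
    fun k => ⟨(s k).1, ?_, hqr k⟩⟩
  · obtain ⟨m, -, h₁, h₂⟩ := hN k
    exact h₁.trans_lt h₂
  · cases k with
    | zero => exact hfD 0 N₀ p₀ h₀
    | succ k => exact hfD (k + 1) _ _ (hsI k)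

/-- A sequence of conditions that almost refine one another has a common almost refinement. -/
lemma exists_lower_bound_seq {p : ℕ → SilverCond} (hinf : ∀ k, (p k).free.Infinite)
    (hp : ∀ k, (p (k + 1)).AlmostRefines (p k)) :
    ∃ q : SilverCond, q.free.Infinite ∧ ∀ k, q.AlmostRefines (p k) := by
  have hg : ∀ k M, ∃ M', (p (k + 1)).Refines M' (p k) ∧ ∃ m ∈ (p k).free, M ≤ m ∧ m < M' := by
    intro k M
    obtain ⟨N, hN⟩ := hp k
    obtain ⟨m, hm, hM⟩ := (hinf k).exists_gt M
    exact ⟨max N (m + 1), hN.mono (le_max_left _ _), m, hm, hM.le,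
      m.lt_succ_self.trans_le (le_max_right _ _)⟩
  choose g hgr hg using hg
  let N : ℕ → ℕ := fun k => Nat.rec 0 (fun k M => g k M) k
  obtain ⟨q, hq, -, hqr⟩ := exists_diagonal (T := univ) (p := p) (N := N) (p 0)
    (fun k => by simpa using hg k (N k)) (fun k => hgr k (N k)) (Refines.refl _ _)
  exact ⟨q, by simpa using hq, fun k => ⟨N k, hqr k⟩⟩

/-- A countable downwards directed family of conditions has a common almost refinement. -/
lemma exists_lower_bound {ι : Type*} [Countable ι] {p : ι → SilverCond}
    (hinf : ∀ i, (p i).free.Infinite)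
    (hp : Directed (fun a b : SilverCond => b.AlmostRefines a) p) :
    ∃ q : SilverCond, q.free.Infinite ∧ ∀ i, q.AlmostRefines (p i) := by
  rcases isEmpty_or_nonempty ι with h | h
  · exact ⟨⟨fun _ => false, univ⟩, infinite_univ, fun i => h.elim i⟩
  · have := Encodable.ofCountable ι
    have := Classical.inhabited_of_nonempty h
    obtain ⟨q, hq, hqr⟩ := exists_lower_bound_seq (p := fun n => p (hp.sequence p n))
      (fun _ => hinf _) (fun n => hp.sequence_mono_nat n)
    exact ⟨q, hq, fun i => (hqr _).trans (hp.rel_sequence i)⟩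

end SilverCond

/-! ### Finite modifications and Baire category -/

/-- The sequence that follows `w` below `N` and `x` from `N` on. -/
def splice (N : ℕ) (w x : ℕ → Bool) : ℕ → Bool := fun n => if n < N then w n else x n

lemma splice_of_lt {N n : ℕ} (h : n < N) (w x : ℕ → Bool) : splice N w x n = w n := by
  simp [splice, h]

lemma splice_of_le {N n : ℕ} (h : N ≤ n) (w x : ℕ → Bool) : splice N w x n = x n := by
  simp [splice, not_lt.2 h]

lemma continuous_splice (N : ℕ) (w : ℕ → Bool) : Continuous (splice N w) := by
  refine continuous_pi fun n => ?_
  by_cases h : n < N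
  · simpa [splice, h] using continuous_const
  · simpa [splice, h] using continuous_apply n

lemma splice_splice (N : ℕ) (w x y : ℕ → Bool) : splice N w (splice N x y) = splice N w y := by
  funext n
  by_cases h : n < N <;> simp [splice, h]

lemma finite_range_splice (N : ℕ) : (range fun w => splice N w).Finite := by
  refine (Set.finite_range fun (v : Fin N → Bool) =>
    splice N fun n => if h : n < N then v ⟨n, h⟩ else false).subset ?_
  rintro _ ⟨w, rfl⟩
  refine ⟨fun i => w i, ?_⟩
  funext x n
  by_cases h : n < N <;> simp [splice, h]

lemma exists_cylinder_subset {u : Set (ℕ → Bool)} (hu : IsOpen u) {w : ℕ → Bool} (hw : w ∈ u) :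
    ∃ N, ∀ x : ℕ → Bool, (∀ n < N, x n = w n) → x ∈ u := by
  obtain ⟨_, ⟨y, N, rfl⟩, hwy, hyu⟩ :=
    (PiNat.isTopologicalBasis_cylinders fun _ : ℕ => Bool).exists_subset_of_mem_open hw hu
  exact ⟨N, fun x hx => hyu fun n hn => (hx n hn).trans (hwy n hn)⟩

lemma dense_preimage_splice {O : Set (ℕ → Bool)} (hd : Dense O) (N : ℕ) (w : ℕ → Bool) :
    Dense (splice N w ⁻¹' O) := by
  refine dense_iff_inter_open.2 fun U hU ⟨x, hx⟩ => ?_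
  obtain ⟨M, hM⟩ := exists_cylinder_subset hU hx
  obtain ⟨y, hy, hyO⟩ := dense_iff_inter_open.1 hd _
    (PiNat.isOpen_cylinder (fun _ : ℕ => Bool) (splice N w x) (max M N))
    ⟨_, PiNat.self_mem_cylinder _ _⟩
  refine ⟨splice N x y, hM _ fun n hn => ?_, ?_⟩
  · by_cases h : n < N
    · rw [splice_of_lt h]
    · rw [splice_of_le (not_lt.1 h), hy n (lt_max_of_lt_left hn), splice_of_le (not_lt.1 h)]
  · change splice N w (splice N x y) ∈ O
    rw [splice_splice]
    convert hyO using 1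
    funext n
    by_cases h : n < N
    · rw [splice_of_lt h, hy n (lt_max_of_lt_right h), splice_of_lt h]
    · rw [splice_of_le (not_lt.1 h)]

/-- An open dense set contains all sequences with a suitable block of values after a bound. -/
lemma exists_block_subset {O : Set (ℕ → Bool)} (ho : IsOpen O) (hd : Dense O) (N : ℕ) :
    ∃ (z : ℕ → Bool) (M : ℕ), ∀ x : ℕ → Bool, (∀ n, N ≤ n → n < M → x n = z n) → x ∈ O := by
  -- One preimage for each of the finitely many patterns below `N`; a cylinder in their intersection
  -- works after every pattern.
  let S : Set (Set (ℕ → Bool)) := (fun f => f ⁻¹' O) '' range fun w => splice N w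
  have hS : S.Finite := (finite_range_splice N).image _
  have hSo : ∀ s ∈ S, IsOpen s := by
    rintro _ ⟨_, ⟨w, rfl⟩, rfl⟩
    exact ho.preimage (continuous_splice N w)
  have hSd : ∀ s ∈ S, Dense s := by
    rintro _ ⟨_, ⟨w, rfl⟩, rfl⟩
    exact dense_preimage_splice hd N w
  obtain ⟨z, hz⟩ := (hS.dense_sInter hSo hSd).nonempty
  obtain ⟨M, hM⟩ := exists_cylinder_subset (hS.isOpen_sInter hSo) hz
  refine ⟨z, M, fun x hx => ?_⟩
  have h := hM (splice N z x) fun n hn => ?_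
  · have hxO : splice N x (splice N z x) ∈ O := h _ ⟨_, ⟨x, rfl⟩, rfl⟩
    rw [splice_splice] at hxO
    convert hxO using 1
    funext n
    by_cases h : n < N <;> simp [splice, h]
  · by_cases h : n < N
    · rw [splice_of_lt h]
    · rw [splice_of_le (not_lt.1 h), hx n (not_lt.1 h) hn]

/-! ### Silver cubes inside Borel sets -/

namespace SilverCond

/-- A set that is comeager in a nonempty open set contains a Silver cube, with free coordinates
in a given infinite set. -/
lemma exists_cube_subset_of_residual {u G : Set (ℕ → Bool)} (hu : IsOpen u) (hne : u.Nonempty)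
    (hG : G ∈ residual (ℕ → Bool)) {T : Set ℕ} (hT : T.Infinite) :
    ∃ q : SilverCond, q.free.Infinite ∧ q.free ⊆ T ∧ q.cube 0 ⊆ u ∩ G := by
  obtain ⟨w, hw⟩ := hne
  obtain ⟨N₀, hN₀⟩ := exists_cylinder_subset hu hw
  obtain ⟨t, htG, ht, htd⟩ := mem_residual.1 hG
  obtain ⟨O, hO, rfl⟩ := ht.eq_iInter_nat
  -- Conditions stay cofinitely free during the fusion, each step prescribing a block that forces `O
  -- k`; the free set is cut down to `T` only afterwards.
  obtain ⟨q, N, hN, -, hq, hq₀, hqD⟩ := fusion (T := T)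
    (I := fun p => ∃ M, ∀ n ≥ M, n ∈ p.free) (D := fun k N p => p.cube N ⊆ O k)
    (fun p ⟨M, hM⟩ => by
      refine infinite_of_not_bddAbove ?_
      rintro ⟨B, hB⟩
      obtain ⟨m, hm, hBm⟩ := hT.exists_gt (max B M)
      have := hB ⟨hM m (le_of_max_le_right hBm.le), hm⟩
      have := le_max_left B M
      omega)
    (fun k N p ⟨M, hM⟩ => by
      obtain ⟨z, L, hz⟩ := exists_block_subset (hO k) (htd.mono (iInter_subset O k)) (max N M)
      refine ⟨⟨splice (max N M) p.val z, {n | n ∈ p.free ∧ n < max N M ∨ L ≤ n ∧ max N M ≤ n}⟩,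
        ⟨max L (max N M), fun n hn => Or.inr ⟨le_of_max_le_left hn, le_of_max_le_right hn⟩⟩,
        fun n hn hp => ?_, fun x hx => hz x fun n hn hnL => ?_⟩
      · have hnM : n < M := by
          by_contra h
          exact hp (hM n (not_lt.1 h))
        have : n < max N M := lt_max_of_lt_right hnM
        refine ⟨?_, splice_of_lt this _ _⟩
        rintro (⟨h, -⟩ | ⟨-, h⟩)
        · exact hp h
        · omega
      · rw [hx n (le_of_max_le_left hn) (by
          rintro (⟨-, h⟩ | ⟨h, -⟩) <;> omega)]
        exact splice_of_le hn _ _)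
    N₀ ⟨w, {n | N₀ ≤ n}⟩ ⟨N₀, fun n hn => hn⟩
  refine ⟨⟨q.val, q.free ∩ T⟩, hq, inter_subset_right, fun x hx => ⟨hN₀ x fun n hn => ?_,
    htG (mem_iInter.2 fun k => ?_)⟩⟩
  · have h := hq₀ n (Nat.zero_le n) (not_le.2 hn)
    exact (hx n (Nat.zero_le n) fun h' => h.1 h'.1).trans h.2
  · obtain ⟨p, hp, hqp⟩ := hqD k
    exact hp (hqp.cube_subset fun n _ hnq => hx n (Nat.zero_le n) fun h' => hnq h'.1)

/-- If countably many Borel sets cover the Cantor space, then every Silver cube with infinitely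
many free coordinates has a subcube within one of them. -/
lemma exists_cube_subset_of_cover {ι : Type*} [Countable ι] {A : ι → Set (ℕ → Bool)}
    (hA : ∀ i, MeasurableSet (A i)) (hcov : ⋃ i, A i = univ) {p : SilverCond}
    (hp : p.free.Infinite) :
    ∃ (q : SilverCond) (i : ι), q.free.Infinite ∧ q.Refines 0 p ∧ q.cube 0 ⊆ A i := by
  classical
  -- A retraction onto `p.cube 0`. The cube may be meager, so category is applied to preimages.
  let φ : (ℕ → Bool) → ℕ → Bool := fun w n => if n ∈ p.free then w n else p.val n
  have hφ : Continuous φ := by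
    refine continuous_pi fun n => ?_
    by_cases h : n ∈ p.free
    · simpa [φ, h] using continuous_apply n
    · simpa [φ, h] using continuous_const
  choose u hu hAu using fun i => ((hA i).preimage hφ.measurable).residualEq_isOpen
  have hres : ∀ i, {w | w ∈ φ ⁻¹' A i ↔ w ∈ u i} ∈ residual (ℕ → Bool) := fun i =>
    eventuallyEq_set.1 (hAu i)
  obtain ⟨w, hw⟩ := (dense_of_mem_residual (countable_iInter_mem.2 hres)).nonempty
  obtain ⟨i, hi⟩ : ∃ i, φ w ∈ A i := by
    rw [← mem_iUnion, hcov]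
    exact mem_univ _
  obtain ⟨q, hq, hqp, hqu⟩ := exists_cube_subset_of_residual (hu i)
    ⟨w, (mem_iInter.1 hw i).1 hi⟩ (hres i) hp
  refine ⟨⟨φ q.val, q.free⟩, i, hq, fun n _ hn => ⟨fun h => hn (hqp h), by simp [φ, hn]⟩, ?_⟩
  intro x hx
  have hy := hqu (show (fun n => if n ∈ q.free then x n else q.val n) ∈ q.cube 0 from
    fun n _ hn => by simp [hn])
  have hxA : φ (fun n => if n ∈ q.free then x n else q.val n) ∈ A i := hy.2.2 hy.1
  convert hxA using 1
  funext n
  by_cases h : n ∈ q.free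
  · simp [φ, h, hqp h]
  · rw [hx n (Nat.zero_le n) h]
    by_cases h' : n ∈ p.free <;> simp [φ, h, h']

/-! ### Deciding a sequence of Borel sets -/

/-- `B` is decided by `p` over the countable set `C`: either no branch of `p` may be added (with
its finite modifications) to `C` if the tails of `B` are to cover all finite sets, or some
subsequence of `B` covers cofinitely each point of `C` and each branch of `p`. -/
def Decides (p : SilverCond) (B : ℕ → Set (ℕ → Bool)) (C : Set (ℕ → Bool)) : Prop :=
  (∀ x ∈ p.branches, ∃ F : Set (ℕ → Bool), F.Finite ∧ F ⊆ C ∪ {y | y =ᶠ[atTop] x} ∧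
    ∃ N, ∀ n ≥ N, ¬ F ⊆ B n) ∨
  ∃ m : ℕ → ℕ, Tendsto m atTop atTop ∧ ∀ x ∈ C ∪ p.branches, ∀ᶠ k in atTop, x ∈ B (m k)

/-- Both alternatives quantify over all branches, so they survive shrinking; hence one condition can
decide for two sets in turn. -/
lemma Decides.of_almostRefines {q p : SilverCond} {B : ℕ → Set (ℕ → Bool)}
    {C : Set (ℕ → Bool)} (h : p.Decides B C) (hq : q.AlmostRefines p) : q.Decides B C := by
  rcases h with h | ⟨m, hm, h⟩
  · exact Or.inl fun x hx => h x (hq.branches_subset hx)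
  · exact Or.inr ⟨m, hm, fun x hx => h x (union_subset_union_right C hq.branches_subset hx)⟩

/-- A fusion is attempted whose `k`-th step puts a cube and the finite set `E k` into one `B n` with
`n ≥ k`. If it never fails, these `n` give the subsequence. If it fails at `k`, `N`, `r`, let `A n`
consist of the points whose modifications below `N` all lie in such a `B n`. Some subcube of `r`
lies in one `A n` or avoids them all. The former would permit the step; in the latter case `E k` and
the modifications of a point below `N` form the bad finite set. -/
lemma exists_decides {B : ℕ → Set (ℕ → Bool)} (hB : ∀ n, MeasurableSet (B n))
    {C : Set (ℕ → Bool)} (hC : C.Countable) {p : SilverCond} (hp : p.free.Infinite) :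
    ∃ q : SilverCond, q.free.Infinite ∧ q.AlmostRefines p ∧ q.Decides B C := by
  obtain ⟨E, hEfin, hEmono, hEC⟩ : ∃ E : ℕ → Set (ℕ → Bool), (∀ k, (E k).Finite) ∧
      Monotone E ∧ ⋃ k, E k = C := by
    rcases C.eq_empty_or_nonempty with rfl | hne
    · exact ⟨fun _ => ∅, fun _ => finite_empty, monotone_const, by simp⟩
    · obtain ⟨c, rfl⟩ := hC.exists_eq_range hne
      refine ⟨fun k => c '' Iic k, fun k => (finite_Iic k).image c,
        fun i j hij => image_mono (Iic_subset_Iic.2 hij), ?_⟩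
      rw [← image_iUnion]
      convert image_univ
      exact eq_univ_of_forall fun n => mem_iUnion.2 ⟨n, le_refl n⟩
  by_cases hstep : ∀ k N (r : SilverCond), (r.free.Infinite ∧ r.AlmostRefines p) →
      ∃ q : SilverCond, (q.free.Infinite ∧ q.AlmostRefines p) ∧ q.Refines N r ∧
        ∃ n ≥ k, E k ⊆ B n ∧ q.cube N ⊆ B n
  · obtain ⟨q, N, -, hN, hq, hqp, hqD⟩ := fusion (T := univ)
      (fun r h => by simpa using h.1) hstep 0 p ⟨hp, AlmostRefines.refl p⟩
    refine ⟨q, by simpa using hq, ⟨0, hqp⟩, Or.inr ?_⟩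
    choose r hr hqr using hqD
    choose m hm hE hcube using hr
    refine ⟨m, tendsto_atTop_mono hm tendsto_id, ?_⟩
    rintro x (hx | ⟨M, hM⟩)
    · rw [← hEC] at hx
      obtain ⟨j, hj⟩ := mem_iUnion.1 hx
      filter_upwards [eventually_ge_atTop j] with k hk using hE k (hEmono hk hj)
    · filter_upwards [eventually_ge_atTop M] with k hk
      exact hcube k ((hqr k).cube_subset (cube_mono (hk.trans (hN.id_le k)) q hM))
  · push Not at hstep
    obtain ⟨k, N, r, ⟨hr, hrp⟩, hbad⟩ := hstep
    let A : ℕ → Set (ℕ → Bool) := fun n =>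
      {x | k ≤ n ∧ E k ⊆ B n ∧ ∀ y : ℕ → Bool, (∀ i ≥ N, y i = x i) → y ∈ B n}
    have hA : ∀ n, MeasurableSet (A n) := by
      intro n
      have h : {x : ℕ → Bool | ∀ y : ℕ → Bool, (∀ i ≥ N, y i = x i) → y ∈ B n} =
          ⋂ f ∈ range fun w => splice N w, f ⁻¹' B n := by
        ext x
        simp only [mem_iInter, mem_range, forall_exists_index, forall_apply_eq_imp_iff]
        refine ⟨fun h w => h _ fun i hi => splice_of_le hi w x, fun h y hy => ?_⟩
        convert (show splice N y x ∈ B n from h y) using 1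
        funext i
        by_cases hi : i < N
        · rw [splice_of_lt hi]
        · rw [splice_of_le (not_lt.1 hi), hy i (not_lt.1 hi)]
      refine (MeasurableSet.const _).inter ((MeasurableSet.const _).inter ?_)
      change MeasurableSet {x : ℕ → Bool | ∀ y : ℕ → Bool, (∀ i ≥ N, y i = x i) → y ∈ B n}
      rw [h]
      refine MeasurableSet.biInter (finite_range_splice N).countable ?_
      rintro _ ⟨w, rfl⟩
      exact (hB n).preimage (continuous_splice N w).measurable
    obtain ⟨q, o, hq, hqr, hqA⟩ := exists_cube_subset_of_cover
      (A := fun o : Option ℕ => o.elim (⋃ n, A n)ᶜ A)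
      (fun o => by
        cases o with
        | none => exact (MeasurableSet.iUnion hA).compl
        | some n => exact hA n)
      (eq_univ_of_forall fun x => by
        by_cases h : x ∈ ⋃ n, A n
        · obtain ⟨n, hn⟩ := mem_iUnion.1 h
          exact mem_iUnion.2 ⟨some n, hn⟩
        · exact mem_iUnion.2 ⟨none, h⟩) hr
    have hqp : q.AlmostRefines p := AlmostRefines.trans ⟨0, hqr⟩ hrp
    refine ⟨q, hq, hqp, Or.inl fun x hx => ?_⟩
    have hqbad := hbad q ⟨hq, hqp⟩ (hqr.mono (Nat.zero_le N))
    cases o with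
    | some n =>
      have hz : q.val ∈ A n := hqA fun _ _ _ => rfl
      refine absurd (fun y hy => ?_) (hqbad n hz.1 hz.2.1)
      exact (hqA (show splice N q.val y ∈ q.cube 0 from fun i _ hi => by
        by_cases h : i < N
        · exact splice_of_lt h _ _
        · rw [splice_of_le (not_lt.1 h), hy i (not_lt.1 h) hi])).2.2 y
          fun i hi => (splice_of_le hi _ _).symm
    | none =>
      obtain ⟨y, hy, hyx⟩ := exists_mem_cube_zero hx
      have hfin : {w : ℕ → Bool | ∀ i ≥ N, w i = y i}.Finite := by
        refine ((finite_range_splice N).image fun f => f y).subset fun w hw => ?_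
        refine ⟨_, ⟨w, rfl⟩, ?_⟩
        funext i
        by_cases hi : i < N
        · exact splice_of_lt hi _ _
        · exact (splice_of_le (not_lt.1 hi) _ _).trans (hw i (not_lt.1 hi)).symm
      refine ⟨E k ∪ {w | ∀ i ≥ N, w i = y i}, (hEfin k).union hfin,
        union_subset_union (hEC ▸ subset_iUnion E k)
          fun w hw => EventuallyEq.trans (eventually_atTop.2 ⟨N, hw⟩) hyx,
        k, fun n hn hsub => hqA hy (mem_iUnion.2 ⟨n, hn, subset_union_left.trans hsub,
          fun w hw => hsub (Or.inr hw)⟩)⟩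

end SilverCond

/-! ### Recursion, counting and pairs with sparse difference -/

/-- Recursion along a well-order: if every initial segment of choices meeting the requirement `G`
can be continued, then all choices can be made so as to meet `G`. -/
lemma exists_wellFounded_choice {S β : Type*} {r : S → S → Prop} [Nonempty β]
    (hr : WellFounded r) (G : ∀ s, (∀ t, r t s → β) → β → Prop)
    (h : ∀ s (f : S → β), (∀ t, r t s → G t (fun u _ => f u) (f t)) →
      ∃ b, G s (fun t _ => f t) b) :
    ∃ f : S → β, ∀ s, G s (fun t _ => f t) (f s) := by
  let f : S → β := hr.fix fun s g => Classical.epsilon (G s g)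
  have hf : ∀ s, f s = Classical.epsilon (G s fun t _ => f t) := fun s => hr.fix_eq _ s
  refine ⟨f, fun s => ?_⟩
  induction s using hr.induction with | _ s ih => ?_
  rw [hf s]
  exact Classical.epsilon_spec (h s f ih)

lemma countable_setOf_eventuallyEq (x : ℕ → Bool) :
    {y : ℕ → Bool | y =ᶠ[atTop] x}.Countable := by
  refine (countable_iUnion fun N => ((finite_range_splice N).image fun f => f x).countable).mono
    fun y hy => ?_
  obtain ⟨N, hN⟩ := eventually_atTop.1 hy
  refine mem_iUnion.2 ⟨N, _, ⟨y, rfl⟩, ?_⟩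
  funext i
  by_cases hi : i < N
  · exact splice_of_lt hi _ _
  · exact (splice_of_le (not_lt.1 hi) _ _).trans (hN i (not_lt.1 hi)).symm

lemma SilverCond.not_countable_cube {p : SilverCond} (hp : p.free.Infinite) :
    ¬ (p.cube 0).Countable := by
  classical
  intro h
  have : Infinite p.free := hp.to_subtype
  let e : Set p.free → ℕ → Bool :=
    fun s n => if h : n ∈ p.free then decide (⟨n, h⟩ ∈ s) else p.val n
  have he : Function.Injective e := by
    intro s t hst
    ext ⟨n, hn⟩
    simpa [e, hn] using congrFun hst n
  have hcount : Countable (Set p.free) := by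
    have := h.to_subtype
    exact Function.Injective.countable (f := fun s => (⟨e s, fun n _ hn => by simp [e, hn]⟩ :
      p.cube 0)) fun s t hst => he (congrArg Subtype.val hst)
  exact (Cardinal.cantor (Cardinal.mk p.free)).not_ge (by
    rw [← Cardinal.mk_set]
    exact (Cardinal.mk_le_aleph0_iff.2 hcount).trans (Cardinal.aleph0_le_mk p.free))

lemma Set.Infinite.exists_strictMono_ge {a : Set ℕ} (ha : a.Infinite) (f : ℕ → ℕ) :
    ∃ d : ℕ → ℕ, StrictMono d ∧ range d ⊆ a ∧ ∀ n, f n ≤ d n := by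
  choose g hga hg using ha.exists_gt
  let d : ℕ → ℕ := fun k => Nat.rec (g (f 0)) (fun k m => g (max m (f (k + 1)))) k
  refine ⟨d, strictMono_nat_of_lt_succ fun k => (le_max_left _ _).trans_lt (hg _), ?_, ?_⟩
  · rintro _ ⟨k, rfl⟩
    cases k <;> exact hga _
  · rintro (_ | k)
    · exact (hg _).le
    · exact (le_max_right _ _).trans (hg _).le

/-- A cube contains two points that differ exactly on a prescribed sparse set and avoid a given
countable set. -/
lemma SilverCond.exists_pair {p : SilverCond} (hp : p.free.Infinite) {Z : Set (ℕ → Bool)}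
    (hZ : Z.Countable) (f : ℕ → ℕ) :
    ∃ x ∈ p.branches, ∃ y ∈ p.branches, x ∉ Z ∧ y ∉ Z ∧
      ∃ d : ℕ → ℕ, StrictMono d ∧ (∀ n, f n ≤ d n) ∧ {n | x n ≠ y n} = range d := by
  classical
  obtain ⟨d, hd, hdp, hfd⟩ := hp.exists_strictMono_ge f
  let flip : (ℕ → Bool) → ℕ → Bool := fun x n => if n ∈ range d then !x n else x n
  have hflip : ∀ x, flip (flip x) = x := by
    intro x
    funext n
    by_cases h : n ∈ range d <;> simp only [flip, h, if_true, if_false, Bool.not_not]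
  -- As `flip` is an involution, avoiding `flip '' Z` keeps the flipped point out of `Z`.
  obtain ⟨x, hx, hxZ⟩ : ∃ x ∈ p.cube 0, x ∉ Z ∪ flip '' Z := by
    by_contra! h
    exact not_countable_cube hp ((hZ.union (hZ.image flip)).mono h)
  refine ⟨x, ⟨0, hx⟩, flip x, ⟨0, fun n hn hnp => ?_⟩, fun h => hxZ (Or.inl h),
    fun h => hxZ (Or.inr ⟨_, h, hflip x⟩), d, hd, hfd, ?_⟩
  · have : n ∉ range d := fun h => hnp (hdp h)
    simpa only [flip, this, if_false] using hx n hn hnp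
  · ext n
    by_cases h : n ∈ range d
    · simp only [mem_ofPred_eq, flip, h, if_true, iff_true]
      cases x n <;> decide
    · simp only [mem_ofPred_eq, flip, h, if_false, ne_eq, not_true_eq_false]

/-! ### The tower under the Continuum Hypothesis -/

/-- Tails of `B` covering all finite subsets of `X` imply that a subsequence of `B` covers each
point of `X` cofinitely, for all sequences `B` of Borel sets. -/
def SeqBorelGamma {α : Type*} [MeasurableSpace α] (X : Set α) : Prop :=
  ∀ B : ℕ → Set α, (∀ n, MeasurableSet (B n)) →
    (∀ F ⊆ X, F.Finite → ∀ N, ∃ n ≥ N, F ⊆ B n) →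
    ∃ m : ℕ → ℕ, Tendsto m atTop atTop ∧ ∀ x ∈ X, ∀ᶠ k in atTop, x ∈ B (m k)

/-- The finite modifications of the points `x t` with `r t s`. -/
def modificationsBelow {S : Type*} (r : S → S → Prop) (s : S) (x : S → ℕ → Bool) :
    Set (ℕ → Bool) :=
  {w | ∃ t, r t s ∧ w =ᶠ[atTop] x t}

/-- The first alternative at `s` contradicts the covering hypothesis, `x s` being a branch of `p s`.
In the second, earlier points lie in the countable set, while `x s` and later points are branches of
`p s`. -/
lemma seqBorelGamma_of_tower {S : Type*} {r : S → S → Prop} [IsWellOrder S r]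
    {p : S → SilverCond} {x : S → ℕ → Bool} (hp : ∀ s t, r t s → (p s).AlmostRefines (p t))
    (hx : ∀ s, x s ∈ (p s).branches)
    (hdec : ∀ B : ℕ → Set (ℕ → Bool), (∀ n, MeasurableSet (B n)) →
      ∃ s, (p s).Decides B (modificationsBelow r s x)) :
    SeqBorelGamma {w | ∃ t, w =ᶠ[atTop] x t} := by
  intro B hB hcov
  obtain ⟨s, h | ⟨m, hm, h⟩⟩ := hdec B hB
  · obtain ⟨F, hF, hFsub, N, hN⟩ := h (x s) (hx s)
    obtain ⟨n, hn, hFB⟩ := hcov F (hFsub.trans (union_subset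
      (fun w ⟨t, _, hw⟩ => ⟨t, hw⟩) fun w hw => ⟨s, hw⟩)) hF N
    exact absurd hFB (hN n hn)
  · refine ⟨m, hm, ?_⟩
    rintro w ⟨t, hw⟩
    refine h w ?_
    rcases trichotomous_of r t s with hts | rfl | hst
    · exact Or.inl ⟨t, hts, hw⟩
    · exact Or.inr (SilverCond.branches_congr (hx t) hw)
    · exact Or.inr (SilverCond.branches_congr ((hp t s hst).branches_subset (hx t)) hw)

lemma exists_wellOrder_countable_initialSegment {S : Type} (hS : Cardinal.mk S ≤ Cardinal.aleph 1) :
    ∃ r : S → S → Prop, IsWellOrder S r ∧ ∀ s, {t | r t s}.Countable := by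
  obtain ⟨r, hr, h⟩ := Cardinal.exists_ord_eq S
  refine ⟨r, hr, fun s => ?_⟩
  have := (Cardinal.card_typein_lt s h).trans_le hS
  rw [← Cardinal.le_aleph0_iff_set_countable]
  rw [← Cardinal.succ_aleph0, Order.lt_succ_iff] at this
  exact this

lemma mk_borelSeq_prod_le :
    Cardinal.mk ((ℕ → {B : Set (ℕ → Bool) // MeasurableSet B}) × (ℕ → ℕ)) ≤
      Cardinal.continuum := by
  have h : Cardinal.mk {B : Set (ℕ → Bool) // MeasurableSet B} ≤ Cardinal.continuum := by
    obtain ⟨b, hb, -, hbasis⟩ := TopologicalSpace.exists_countable_basis (ℕ → Bool)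
    have := MeasurableSpace.cardinal_measurableSet_le_continuum
      ((Cardinal.le_aleph0_iff_set_countable.2 hb).trans Cardinal.aleph0_le_continuum)
    rwa [← hbasis.borel_eq_generateFrom, ← BorelSpace.measurable_eq] at this
  rw [Cardinal.mk_prod, Cardinal.lift_id, Cardinal.lift_id]
  refine (mul_le_mul' (?_ : _ ≤ Cardinal.continuum) (?_ : _ ≤ Cardinal.continuum)).trans
    Cardinal.continuum_mul_self.le
  · rw [← Cardinal.power_def, Cardinal.mk_nat]
    exact (Cardinal.power_le_power_right h).trans Cardinal.continuum_power_aleph0.le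
  · simp

/-- Under the Continuum Hypothesis there are two Borel γ-sets in the Cantor space, no point of
one being almost equal to a point of the other, such that the sets of differences of pairs of
points are as sparse as desired. -/
theorem exists_pair_seqBorelGamma (CH : Cardinal.continuum.{0} = Cardinal.aleph.{0} 1) :
    ∃ X Y : Set (ℕ → Bool), SeqBorelGamma X ∧ SeqBorelGamma Y ∧
      (∀ x ∈ X, ∀ y ∈ Y, ¬ x =ᶠ[atTop] y) ∧
      ∀ f : ℕ → ℕ, ∃ x ∈ X, ∃ y ∈ Y, ∃ d : ℕ → ℕ,
        StrictMono d ∧ (∀ n, f n ≤ d n) ∧ {n | x n ≠ y n} = range d := by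
  let S := (ℕ → {B : Set (ℕ → Bool) // MeasurableSet B}) × (ℕ → ℕ)
  obtain ⟨r, hr, hcount⟩ :=
    exists_wellOrder_countable_initialSegment (S := S) (mk_borelSeq_prod_le.trans CH.le)
  have hbelow : ∀ (s : S) (x : S → ℕ → Bool), (modificationsBelow r s x).Countable := by
    intro s x
    refine ((hcount s).biUnion fun t _ => countable_setOf_eventuallyEq (x t)).mono ?_
    rintro w ⟨t, ht, hw⟩
    exact mem_biUnion ht hw
  have : Nonempty (SilverCond × (ℕ → Bool) × (ℕ → Bool)) :=
    ⟨⟨fun _ => false, univ⟩, fun _ => false, fun _ => false⟩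
  -- A condition and two new points: the condition decides `s.1` over both sets of old points, and
  -- the differences outgrow `s.2`.
  let G : ∀ s : S, (∀ t, r t s → SilverCond × (ℕ → Bool) × (ℕ → Bool)) →
      SilverCond × (ℕ → Bool) × (ℕ → Bool) → Prop := fun s f b =>
      b.1.free.Infinite ∧ (∀ t h, b.1.AlmostRefines (f t h).1) ∧
      b.1.Decides (fun n => s.1 n) {w | ∃ t h, w =ᶠ[atTop] (f t h).2.1} ∧
      b.1.Decides (fun n => s.1 n) {w | ∃ t h, w =ᶠ[atTop] (f t h).2.2} ∧
      b.2.1 ∈ b.1.branches ∧ b.2.2 ∈ b.1.branches ∧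
      (∀ t h, ¬ b.2.1 =ᶠ[atTop] (f t h).2.2) ∧ (∀ t h, ¬ b.2.2 =ᶠ[atTop] (f t h).2.1) ∧
      ∃ d : ℕ → ℕ, StrictMono d ∧ (∀ n, s.2 n ≤ d n) ∧ {n | b.2.1 n ≠ b.2.2 n} = range d
  have hstep : ∀ s (f : S → SilverCond × (ℕ → Bool) × (ℕ → Bool)),
      (∀ t, r t s → G t (fun u _ => f u) (f t)) → ∃ b, G s (fun t _ => f t) b := by
    intro s f hf
    have : Countable {t | r t s} := (hcount s).to_subtype
    obtain ⟨p, hp, hpf⟩ := SilverCond.exists_lower_bound (ι := {t | r t s})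
      (p := fun t => (f t).1) (fun t => (hf t t.2).1) (by
        rintro ⟨t, ht⟩ ⟨u, hu⟩
        rcases trichotomous_of r t u with h | rfl | h
        · exact ⟨⟨u, hu⟩, (hf u hu).2.1 t h, SilverCond.AlmostRefines.refl _⟩
        · exact ⟨⟨t, ht⟩, SilverCond.AlmostRefines.refl _, SilverCond.AlmostRefines.refl _⟩
        · exact ⟨⟨t, ht⟩, SilverCond.AlmostRefines.refl _, (hf t ht).2.1 u h⟩)
    have hcX := hbelow s fun t => (f t).2.1
    have hcY := hbelow s fun t => (f t).2.2
    obtain ⟨q, hq, hqp, hqX⟩ := SilverCond.exists_decides (fun n => (s.1 n).2) hcX hp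
    obtain ⟨q', hq', hqq, hqY⟩ := SilverCond.exists_decides (fun n => (s.1 n).2) hcY hq
    obtain ⟨x, hx, y, hy, hxZ, hyZ, hd⟩ := SilverCond.exists_pair hq' (hcX.union hcY) s.2
    refine ⟨(q', x, y), hq', fun t h => (hqq.trans hqp).trans (hpf ⟨t, h⟩), ?_, ?_, hx, hy,
      fun t h h' => hxZ (Or.inr ⟨t, h, h'⟩), fun t h h' => hyZ (Or.inl ⟨t, h, h'⟩), hd⟩
    · simpa [modificationsBelow] using hqX.of_almostRefines hqq
    · simpa [modificationsBelow] using hqY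
  obtain ⟨g, hg⟩ := exists_wellFounded_choice (inferInstance : IsWellFounded S r).wf G hstep
  choose hinf href hdX hdY hX hY hXY hYX hdiff using hg
  have hbelow' : ∀ (s : S) (x : S → ℕ → Bool),
      {w | ∃ t, ∃ _ : r t s, w =ᶠ[atTop] x t} = modificationsBelow r s x := by
    intro s x
    simp [modificationsBelow]
  -- A stage treats a sequence and a function together; `id` and the empty sets are fillers where
  -- only one matters.
  refine ⟨{w | ∃ t, w =ᶠ[atTop] (g t).2.1}, {w | ∃ t, w =ᶠ[atTop] (g t).2.2},
    seqBorelGamma_of_tower (r := r) href hX fun B hB => ⟨(fun n => ⟨B n, hB n⟩, id), ?_⟩,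
    seqBorelGamma_of_tower (r := r) href hY fun B hB => ⟨(fun n => ⟨B n, hB n⟩, id), ?_⟩,
    ?_, ?_⟩
  · simpa only [hbelow' _ fun t => (g t).2.1] using hdX (fun n => ⟨B n, hB n⟩, id)
  · simpa only [hbelow' _ fun t => (g t).2.2] using hdY (fun n => ⟨B n, hB n⟩, id)
  · rintro x ⟨s, hs⟩ y ⟨t, ht⟩ hxy
    have h := (hs.symm.trans hxy).trans ht
    rcases trichotomous_of r s t with hst | rfl | hts
    · exact hYX t s hst h.symm
    · obtain ⟨d, hd, -, hrange⟩ := hdiff s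
      obtain ⟨N, hN⟩ := eventually_atTop.1 h
      have hmem : d N ∈ {n | (g s).2.1 n ≠ (g s).2.2 n} := hrange ▸ mem_range_self N
      exact hmem (hN _ (hd.id_le N))
    · exact hXY s t hts h
  · intro f
    exact ⟨_, ⟨(fun _ => ⟨∅, MeasurableSet.empty⟩, f), EventuallyEq.rfl⟩, _,
      ⟨_, EventuallyEq.rfl⟩, hdiff (fun _ => ⟨∅, MeasurableSet.empty⟩, f)⟩

lemma SeqBorelGamma.image {α β : Type*} [MeasurableSpace α] [MeasurableSpace β] {X : Set α}
    (hX : SeqBorelGamma X) {e : α → β} (he : Measurable e) : SeqBorelGamma (e '' X) := by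
  intro B hB hcov
  obtain ⟨m, hm, h⟩ := hX (fun n => e ⁻¹' B n) (fun n => (hB n).preimage he) fun F hF hfin N => by
    obtain ⟨n, hn, h⟩ := hcov (e '' F) (image_mono hF) (hfin.image e) N
    exact ⟨n, hn, image_subset_iff.1 h⟩
  exact ⟨m, hm, forall_mem_image.2 h⟩

/-! ### Covers, γ-properties and Menger's property -/

namespace SelCov

lemma CoversFinite.sUnion_eq {X : Type*} {U : Set (Set X)} (hU : CoversFinite U) :
    ⋃₀ U = univ := eq_univ_of_forall fun x => by
  obtain ⟨u, hu, hx⟩ := hU {x} (finite_singleton x)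
  exact ⟨u, hu, hx rfl⟩

/-- For an ω-cover without the trivial member, finite sets are covered by members outside a given
finite subfamily. -/
lemma CoversFinite.exists_notMem {X : Type*} {U : Set (Set X)} (hU : CoversFinite U)
    (huniv : univ ∉ U) {W : Set (Set X)} (hW : W.Finite) {F : Set X} (hF : F.Finite) :
    ∃ u ∈ U, u ∉ W ∧ F ⊆ u := by
  have h : ∀ u ∈ W ∩ U, ∃ x, x ∉ u := by
    intro u hu
    by_contra! hx
    exact huniv (eq_univ_of_forall hx ▸ hu.2)
  have hW' := hW.inter_of_left U
  have : Nonempty X := by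
    by_contra hX
    have := not_nonempty_iff.1 hX
    obtain ⟨u, hu, -⟩ := hU ∅ finite_empty
    exact huniv (Subsingleton.elim u univ ▸ hu)
  choose! x hx using h
  obtain ⟨u, hu, hFu⟩ := hU (F ∪ x '' (W ∩ U)) (hF.union (hW'.image x))
  exact ⟨u, hu, fun huW => hx u ⟨huW, hu⟩ (hFu (Or.inr ⟨u, ⟨huW, hu⟩, rfl⟩)),
    subset_union_left.trans hFu⟩

lemma CoversFinite.infinite {X : Type*} {U : Set (Set X)} (hU : CoversFinite U)
    (huniv : univ ∉ U) : U.Infinite := fun hfin => by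
  obtain ⟨u, hu, hu', -⟩ := hU.exists_notMem huniv hfin finite_empty
  exact hu' hu

lemma CoversCofinitely.sUnion_eq {X : Type*} {U : Set (Set X)} (hU : CoversCofinitely U) :
    ⋃₀ U = univ := eq_univ_of_forall fun x => by
  by_contra h
  refine hU.1 ((hU.2 x).subset fun u hu => ⟨hu, fun hx => h ⟨u, hu, hx⟩⟩)

/-- An open ω-cover of a second countable space has a countable ω-subcover. -/
lemma CoversFinite.exists_countable_subset {X : Type*} [TopologicalSpace X]
    [SecondCountableTopology X] {U : Set (Set X)} (hU : CoversFinite U)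
    (ho : ∀ u ∈ U, IsOpen u) : ∃ V ⊆ U, V.Countable ∧ CoversFinite V := by
  obtain ⟨b, hb, -, hbasis⟩ := TopologicalSpace.exists_countable_basis X
  let S : Set (Set (Set X)) := {s | (s.Finite ∧ s ⊆ b) ∧ ∃ u ∈ U, ⋃₀ s ⊆ u}
  have hS : S.Countable := (countable_ofPred_finite_subset hb).mono fun s hs => hs.1
  have h : ∀ s ∈ S, ∃ u ∈ U, ⋃₀ s ⊆ u := fun s hs => hs.2
  choose! g hgU hg using h
  refine ⟨g '' S, image_subset_iff.2 hgU, hS.image g, fun F hF => ?_⟩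
  obtain ⟨u, hu, hFu⟩ := hU F hF
  have hx : ∀ x ∈ F, ∃ v ∈ b, x ∈ v ∧ v ⊆ u := fun x hx =>
    hbasis.exists_subset_of_mem_open (hFu hx) (ho u hu)
  choose! v hvb hxv hvu using hx
  have hs : v '' F ∈ S :=
    ⟨⟨hF.image v, image_subset_iff.2 hvb⟩, u, hu, sUnion_subset (forall_mem_image.2 hvu)⟩
  exact ⟨g (v '' F), mem_image_of_mem g hs, fun x hx =>
    hg _ hs ⟨v x, mem_image_of_mem v hx, hxv x hx⟩⟩

lemma IsBorelGammaSpace.isGammaSpace {X : Type*} [TopologicalSpace X] [SecondCountableTopology X]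
    (hX : IsBorelGammaSpace X) : IsGammaSpace X := by
  rintro U ⟨⟨⟨-, huniv⟩, ho⟩, hU⟩
  obtain ⟨V, hVU, hV, hVfin⟩ := hU.exists_countable_subset ho
  obtain ⟨W, ⟨⟨hWcov, -, -⟩, hW⟩, hWV⟩ := hX V
    ⟨⟨⟨hVfin.sUnion_eq, fun h => huniv (hVU h)⟩, hV, fun u hu => by
      borelize X
      exact (ho u (hVU hu)).measurableSet⟩, hVfin⟩
  exact ⟨W, ⟨⟨hWcov, fun u hu => ho u (hVU (hWV hu))⟩, hW⟩, hWV.trans hVU⟩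

/-- Borel sets of the subspace are traces of ambient ones. The enumeration of the cover is
injective, so indices tending to infinity select infinitely many members. -/
lemma _root_.SeqBorelGamma.isBorelGammaSpace {α : Type*} [TopologicalSpace α]
    [MeasurableSpace α] [BorelSpace α] {X : Set α} (hX : SeqBorelGamma X) :
    IsBorelGammaSpace X := by
  rintro U ⟨⟨⟨-, huniv⟩, hcount, hborel⟩, hU⟩
  have := (hU.infinite huniv).to_subtype
  have := hcount.to_subtype
  obtain ⟨ε⟩ : Nonempty (ℕ ≃ U) := nonempty_equiv_of_countable
  have hB : ∀ n, ∃ B : Set α, MeasurableSet B ∧ Subtype.val ⁻¹' B = (ε n : Set X) := fun n => by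
    have h := hborel _ (ε n).2
    rwa [← BorelSpace.measurable_eq] at h
  choose B hBm hB using hB
  obtain ⟨m, hm, hcof⟩ := hX B hBm fun F hF hfin N => by
    obtain ⟨u, hu, huN, hFu⟩ := hU.exists_notMem huniv
      ((finite_Iio N).image fun n => (ε n : Set X))
      (hfin.preimage (f := (Subtype.val : X → α)) Subtype.val_injective.injOn)
    obtain ⟨n, hn⟩ := ε.surjective ⟨u, hu⟩
    refine ⟨n, ?_, fun x hx => ?_⟩
    · by_contra h
      exact huN ⟨n, not_le.1 h, by simp [hn]⟩
    · have h : (⟨x, hF hx⟩ : X) ∈ u := hFu hx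
      have hBu := hB n
      rw [hn] at hBu
      have hxB : (⟨x, hF hx⟩ : X) ∈ Subtype.val ⁻¹' B n := by
        rw [hBu]
        exact h
      exact hxB
  have hsub : range (fun k => (ε (m k) : Set X)) ⊆ U := range_subset_iff.2 fun k => (ε (m k)).2
  have hγ : CoversCofinitely (range fun k => (ε (m k) : Set X)) := by
    refine ⟨fun hfin => ?_, fun x => ?_⟩
    · have hinj : Function.Injective fun n => (ε n : Set X) :=
        Subtype.val_injective.comp ε.injective
      have hfin' : (range m).Finite := by
        refine Finite.of_finite_image (f := fun n => (ε n : Set X)) ?_ hinj.injOn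
        rwa [← range_comp]
      obtain ⟨b, hb⟩ := hfin'.bddAbove
      obtain ⟨k, hk⟩ := (hm.eventually_gt_atTop b).exists
      exact absurd (hb (mem_range_self k)) (not_le.2 hk)
    · obtain ⟨K, hK⟩ := eventually_atTop.1 (hcof x x.2)
      refine ((finite_Iio K).image fun k => (ε (m k) : Set X)).subset ?_
      rintro _ ⟨⟨k, rfl⟩, hk⟩
      refine ⟨k, ?_, rfl⟩
      by_contra h
      exact hk ((hB (m k)).subset (hK k (not_lt.1 h)))
  exact ⟨_, ⟨⟨⟨hγ.sUnion_eq, fun h => huniv (hsub h)⟩, hcount.mono hsub,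
    fun u hu => hborel u (hsub hu)⟩, hγ⟩, hsub⟩

/-- A space with a dominating continuous image in `ℕ → ℕ` is not Menger. -/
lemma not_isMenger_of_isDominating {X : Type*} [TopologicalSpace X] {Φ : X → ℕ → ℕ}
    (hΦ : Continuous Φ) (hdom : IsDominating (range Φ)) : ¬ IsMenger X := by
  intro hX
  -- A bounded coordinate would put the whole space into the covers below. Only finitely many are
  -- bounded, since a function exceeding all existing bounds is dominated.
  obtain ⟨N, hN⟩ : ∃ N, ∀ n ≥ N, ∀ k, ∃ x, k < Φ x n := by
    by_contra! h
    have hk : ∀ n, ∃ k, (∃ j, ∀ x, Φ x n ≤ j) → ∀ x, Φ x n ≤ k := fun n => by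
      by_cases hj : ∃ j, ∀ x, Φ x n ≤ j
      · exact ⟨hj.choose, fun _ => hj.choose_spec⟩
      · exact ⟨0, fun h => absurd h hj⟩
    choose k hk using hk
    obtain ⟨_, ⟨x, rfl⟩, hx⟩ := hdom fun n => k n + 1
    obtain ⟨M, hM⟩ := eventually_atTop.1 hx
    obtain ⟨n, hn, hj⟩ := h M
    exact absurd (hk n hj x) (not_le.2 (hM n hn))
  -- One sequence of covers per tail `m`: domination ignores finitely many coordinates, so bounds
  -- are needed arbitrarily far out.
  have hcov : ∀ m n, (range fun k => {x | Φ x (N + m + n) ≤ k}) ∈ OpenCovers X := by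
    intro m n
    refine ⟨⟨eq_univ_of_forall fun x => ⟨_, ⟨Φ x (N + m + n), rfl⟩, (le_refl (Φ x (N + m + n)) :)⟩, ?_⟩, ?_⟩
    · rintro ⟨k, hk⟩
      obtain ⟨x, hx⟩ := hN (N + m + n) (by omega) k
      exact not_le.2 hx (hk.symm.subset (mem_univ x))
    · rintro _ ⟨k, rfl⟩
      exact (isOpen_discrete (Iic k)).preimage ((continuous_apply _).comp hΦ)
  choose F hF hFcov using fun m => hX _ (hcov m)
  have hb : ∀ m n, ∃ b, ∀ u ∈ F m n, ∀ x ∈ u, Φ x (N + m + n) ≤ b := by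
    intro m n
    have hk : ∀ u ∈ F m n, ∃ k, {x | Φ x (N + m + n) ≤ k} = u := fun u hu => (hF m n).1 hu
    choose! k hk using hk
    obtain ⟨b, hb⟩ := ((hF m n).2.image k).bddAbove
    refine ⟨b, fun u hu x hx => ?_⟩
    have hx' : x ∈ {x | Φ x (N + m + n) ≤ k u} := (hk u hu).symm ▸ hx
    exact le_trans hx' (hb ⟨u, hu, rfl⟩)
  choose b hb using hb
  -- At `j = N + m + n` the sum contains `b m n`, and the 1 makes the excess strict.
  obtain ⟨_, ⟨x, rfl⟩, hx⟩ :=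
    hdom fun j => 1 + ∑ m ∈ Finset.range (j + 1), b m (j - N - m)
  obtain ⟨J, hJ⟩ := eventually_atTop.1 hx
  obtain ⟨u, hu, hxu⟩ : x ∈ ⋃₀ ⋃ n, F J n := (hFcov J).1.1 ▸ mem_univ x
  obtain ⟨n, hn⟩ := mem_iUnion.1 hu
  have h₁ := hb J n u hn x hxu
  have h₂ := hJ (N + J + n) (by omega)
  have h₃ := Finset.single_le_sum (f := fun m => b m (N + J + n - N - m))
    (fun _ _ => Nat.zero_le _) (Finset.mem_range.2 (show J < N + J + n + 1 by omega))
  have h₄ : N + J + n - N - J = n := by omega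
  simp only [h₄] at h₃
  omega

end SelCov

/-! ### Enumerating differences and transfer to the reals -/

/-- The increasing enumeration of the differences of two sequences depends continuously on
them. -/
lemma continuous_nth_ne {Z : Type*} [TopologicalSpace Z] {a b : Z → ℕ → Bool} (ha : Continuous a)
    (hb : Continuous b) (hinf : ∀ z, {n | a z n ≠ b z n}.Infinite) :
    Continuous fun z n => Nat.nth (fun i => a z i ≠ b z i) n := by
  refine continuous_pi fun n => ?_
  -- Whether the `n`-th difference occurs before `m` depends only on coordinates below `m`.
  have hclopen : ∀ m, IsClopen {z | Nat.nth (fun i => a z i ≠ b z i) n < m} := by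
    intro m
    have hcount : Continuous fun z => Nat.count (fun i => a z i ≠ b z i) m := by
      induction m with
      | zero => simpa using continuous_const
      | succ m ih =>
        simp only [Nat.count_succ]
        refine ih.add ?_
        exact (continuous_of_discreteTopology (f := fun q : Bool × Bool =>
          if q.1 ≠ q.2 then 1 else 0)).comp
            (((continuous_apply m).comp ha).prodMk ((continuous_apply m).comp hb))
    convert (isClopen_discrete (Ioi n)).preimage hcount using 1
    ext z
    exact (Nat.lt_nth_iff_count_lt (hinf z)).symm
  refine continuous_discrete_rng.2 fun m => ?_
  convert ((hclopen (m + 1)).diff (hclopen m)).isOpen using 1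
  ext z
  simp only [mem_preimage, mem_singleton_iff, Set.mem_sdiff, mem_ofPred_eq]
  omega

/-- Below `d n`, only the values `d j` with `j < n` satisfy `P`. -/
lemma le_nth_of_range_eq {P : ℕ → Prop} {d : ℕ → ℕ} (hd : StrictMono d)
    (hP : {n | P n} = range d) (n : ℕ) : d n ≤ Nat.nth P n := by
  classical
  have hinf : {n | P n}.Infinite := hP ▸ infinite_range_of_injective hd.injective
  by_contra! h
  rw [← Nat.lt_nth_iff_count_lt hinf, Nat.count_eq_card_filter_range] at h
  refine absurd (h.trans_le ((Finset.card_le_card (t := (Finset.range n).image d)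
    fun i hi => ?_).trans Finset.card_image_le)) (by simp)
  rw [Finset.mem_filter, Finset.mem_range] at hi
  obtain ⟨j, rfl⟩ : i ∈ range d := hP ▸ hi.2
  exact Finset.mem_image_of_mem d (Finset.mem_range.2 (hd.lt_iff_lt.1 hi.1))

theorem theorem3p2 (CH : Cardinal.continuum.{0} = Cardinal.aleph.{0} 1) :
    ∃ X Y : Set ℝ,
      SelCov.IsBorelGammaSpace X ∧ SelCov.IsBorelGammaSpace Y ∧
      SelCov.IsGammaSpace X ∧ SelCov.IsGammaSpace Y ∧
      ¬ SelCov.IsMenger (X × Y) ∧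
      ∃ Φ : X × Y → (ℕ → ℕ), Continuous Φ ∧ SelCov.IsDominating (Set.range Φ) := by
  obtain ⟨X, Y, hX, hY, hXY, hdiff⟩ := exists_pair_seqBorelGamma CH
  obtain ⟨e, -, he, hinj⟩ := (isClosed_univ (X := ℝ)).exists_nat_bool_injection_of_not_countable
    not_countable_univ
  have hX' := (hX.image he.measurable).isBorelGammaSpace
  have hY' := (hY.image he.measurable).isBorelGammaSpace
  -- By compactness the continuous injection `e` is an embedding, so points are recovered
  -- continuously from their images.
  let h := (he.isClosedEmbedding hinj).isEmbedding.toHomeomorph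
  have hh : ∀ w (hw : e w ∈ range e), h.symm ⟨e w, hw⟩ = w := fun w _ =>
    h.symm_apply_eq.2 rfl
  let a : (e '' X) × (e '' Y) → ℕ → Bool := fun z =>
    h.symm ⟨z.1, image_subset_range e X z.1.2⟩
  let b : (e '' X) × (e '' Y) → ℕ → Bool := fun z =>
    h.symm ⟨z.2, image_subset_range e Y z.2.2⟩
  have ha : Continuous a := h.symm.continuous.comp
    ((continuous_subtype_val.comp continuous_fst).subtype_mk _)
  have hb : Continuous b := h.symm.continuous.comp
    ((continuous_subtype_val.comp continuous_snd).subtype_mk _)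
  have hinf : ∀ z, {n | a z n ≠ b z n}.Infinite := by
    rintro ⟨⟨_, x, hx, rfl⟩, ⟨_, y, hy, rfl⟩⟩
    simp only [a, b, hh]
    rw [← Nat.frequently_atTop_iff_infinite]
    exact not_eventually.1 (hXY x hx y hy)
  have hΦ := continuous_nth_ne ha hb hinf
  have hdom : SelCov.IsDominating
      (range fun z n => Nat.nth (fun i => a z i ≠ b z i) n) := by
    intro f
    obtain ⟨x, hx, y, hy, d, hd, hfd, hrange⟩ := hdiff f
    refine ⟨_, ⟨(⟨e x, x, hx, rfl⟩, ⟨e y, y, hy, rfl⟩), rfl⟩, Eventually.of_forall fun n => ?_⟩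
    simp only [a, b, hh]
    exact (hfd n).trans (le_nth_of_range_eq hd hrange n)
  exact ⟨e '' X, e '' Y, hX', hY', hX'.isGammaSpace, hY'.isGammaSpace,
    SelCov.not_isMenger_of_isDominating hΦ hdom, _, hΦ, hdom⟩
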